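/- Let $K$ be an algebraically closed field of characteristic $2$. Call a quartic surface $X=\{F=0\}\subset\mathbb{P}^3_K$ (with $F\neq 0$ a quartic form) symmetric if $F\in K[x_1,x_2,x_3,x_4]$ is invariant under all permutations of the variables, and normal if its singular set $$\mathrm{Sing}(X)=\Big\{x\in\mathbb{P}^3(K) : F(x)=\tfrac{\partial F}{\partial x_i}(x)=0,\ 1\le i\le 4\Big\}$$ is finite. Let $\sigma_i$ denote the $i$-th elementary symmetric polynomial in $x_1,\dots,x_4$. (1) The maximal number of singular points of a normal symmetric quartic surface over $K$ is exactly $12$: every normal symmetric quartic $X$ has $|\mathrm{Sing}(X)|\le 12$, and there is one with $|\mathrm{Sing}(X)|=12$. (2) For every $\beta\in K$ with $\beta\neq 0$, the quartic $X=\{\sigma_4+\beta\sigma_2^2=0\}$ has exactly $4$ singular points. Each of them is a uniplanar double point, that is, in affine coordinates centred at the point the equation of $X$ has the form $\ell^2+g$ with $\ell$ a nonzero linear form and $g$ of order at least $3$. Each of them is a singularity of type $D_4$, that is, the completed local ring of $X$ at the point is isomorphic to $K[[x,y,z]]/(f)$, where $f$ is one of the two normal forms of Artin in characteristic $2$ of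 a rational double point with Dynkin diagram $D_4$: $f=z^2+x^2y+xy^2$ (type $D_4^0$) or $f=z^2+x^2y+xy^2+xyz$ (type $D_4^1$). -/

import Mathlib

open scoped LinearAlgebra.Projectivization

noncomputable section

namespace SymmetricQuartic

variable {K : Type*} [Field K]

/-- The singular points in `ℙ³` of the surface `F = 0`, for `F` homogeneous: the points at which
`F` and all its first partial derivatives vanish. (For homogeneous `F` the condition does not
depend on the vector that represents the point.) -/
def singularPoints (F : MvPolynomial (Fin 4) K) : Set (ℙ K (Fin 4 → K)) :=
  {p | MvPolynomial.eval p.rep F = 0 ∧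
    ∀ i : Fin 4, MvPolynomial.eval p.rep (MvPolynomial.pderiv i F) = 0}

/-- `F = 0` is a normal quartic surface in `ℙ³`: it is defined by a nonzero quartic form and has
only finitely many singular points. -/
structure IsNormalQuartic (F : MvPolynomial (Fin 4) K) : Prop where
  isHomogeneous : F.IsHomogeneous 4
  ne_zero : F ≠ 0
  finite_singularPoints : (singularPoints F).Finite

/-- The quartic form `σ₄ + β σ₂²`, where `σᵢ` are the elementary symmetric polynomials in the four
homogeneous coordinates. -/
def family (β : K) : MvPolynomial (Fin 4) K :=
  MvPolynomial.esymm (Fin 4) K 4 + MvPolynomial.C β * MvPolynomial.esymm (Fin 4) K 2 ^ 2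

/-- The equation of the surface `F = 0` in the affine chart `xᵢ = 1`, in the affine coordinates
of that chart translated so that `p` becomes the origin (meaningful if the `i`-th coordinate of
`p` is nonzero). -/
def localEquation (F : MvPolynomial (Fin 4) K) (p : ℙ K (Fin 4 → K)) (i : Fin 4) :
    MvPolynomial (Fin 3) K :=
  MvPolynomial.aeval
    (i.insertNth (α := fun _ => MvPolynomial (Fin 3) K) 1
      (fun k => MvPolynomial.C (p.rep (i.succAbove k) / p.rep i) + MvPolynomial.X k)) F

/-- `p` is a uniplanar double point of `F = 0`: the Taylor development of the equation at `p` is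
`ℓ² + g`, with `ℓ` a nonzero linear form and `g` of order at least `3`. -/
def IsUniplanarDoublePoint (F : MvPolynomial (Fin 4) K) (p : ℙ K (Fin 4 → K)) : Prop :=
  ∀ i : Fin 4, p.rep i ≠ 0 →
    MvPolynomial.homogeneousComponent 0 (localEquation F p i) = 0 ∧
    MvPolynomial.homogeneousComponent 1 (localEquation F p i) = 0 ∧
    ∃ l : MvPolynomial (Fin 3) K, l.IsHomogeneous 1 ∧ l ≠ 0 ∧
      MvPolynomial.homogeneousComponent 2 (localEquation F p i) = l ^ 2

/-- The complete local ring at the origin of the hypersurface germ `f = 0` in affine 3-space: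
`K⟦t₀, t₁, t₂⟧ / (f)`. -/
abbrev CompleteLocalRing (f : MvPolynomial (Fin 3) K) : Type _ :=
  MvPowerSeries (Fin 3) K ⧸ Ideal.span {(f : MvPowerSeries (Fin 3) K)}

/-- Artin's normal form `z² + x²y + xy²` of the rational double point `D₄⁰` in characteristic
`2`. -/
def formD40 (K : Type*) [Field K] : MvPolynomial (Fin 3) K :=
  MvPolynomial.X 2 ^ 2 + MvPolynomial.X 0 ^ 2 * MvPolynomial.X 1 +
    MvPolynomial.X 0 * MvPolynomial.X 1 ^ 2

/-- Artin's normal form `z² + x²y + xy² + xyz` of the rational double point `D₄¹` in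
characteristic `2`. -/
def formD41 (K : Type*) [Field K] : MvPolynomial (Fin 3) K :=
  formD40 K + MvPolynomial.X 0 * MvPolynomial.X 1 * MvPolynomial.X 2

/-- `p` is a singularity of type `D₄` of `F = 0` (`K` algebraically closed of characteristic `2`):
the completed local ring of the surface at `p` is isomorphic to that of one of the two rational
double points `D₄⁰`, `D₄¹` with Dynkin diagram `D₄`. -/
def IsTypeD4 (F : MvPolynomial (Fin 4) K) (p : ℙ K (Fin 4 → K)) : Prop :=
  ∀ i : Fin 4, p.rep i ≠ 0 →
    Nonempty (CompleteLocalRing (localEquation F p i) ≃ₐ[K] CompleteLocalRing (formD40 K)) ∨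
    Nonempty (CompleteLocalRing (localEquation F p i) ≃ₐ[K] CompleteLocalRing (formD41 K))

end SymmetricQuartic

end

/-! Every symmetric quartic form is `p σ₁⁴ + q σ₁²σ₂ + r σ₁σ₃ + t σ₄ + u σ₂²`
(`exists_eq_symmetricForm`). In characteristic 2 its `i`-th partial derivative is a polynomial of
degree at most 3 in `xᵢ` whose coefficients do not depend on `i`, so all coordinates of a singular
point are roots of one cubic (`eval_pderiv_symmetricForm`). If `t ≠ 0`, two coordinates agree, and
the point is a rearrangement of `(x, x, y, z)` with `σ₁ = y + z`.

Take `t = 1`. When `σ₁ = 1`, the equations become `x² = q`, one of `x = r`, `x = y`, `x = z`, and a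
condition from `F`. If `u ≠ 0`, that condition fixes `y² + y`, hence the pair `{y, y + 1}`, while
`σ₁ = 0` is impossible; only the positions of `y` and `z` remain, at most 12. If `u = 0`, normality
leaves at most 6 points with `σ₁ = 0` and 4 with `σ₁ = 1`. For `t = 0` the surface is either
singular along a curve or has at most 5 singular points. The form `σ₁⁴ + σ₄ + σ₂²` attains 12.

The singular points of `σ₄ + βσ₂²` are the coordinate points. There an explicit change of formal
coordinates carries `D₄¹` to a unit times the local equation (`exists_algEquiv_formD41`); inverting
it requires an Artin–Schreier equation over the power series ring. -/

namespace SymmetricQuartic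
open MvPolynomial

/-! ### Symmetric quartic forms and their partial derivatives. -/

section
variable {R : Type*} [CommRing R]

theorem esymm_fin_four_one : esymm (Fin 4) R 1 = X 0 + X 1 + X 2 + X 3 := by
  rw [esymm_one, Fin.sum_univ_four]

theorem esymm_fin_four_two : esymm (Fin 4) R 2 =
    X 0 * X 1 + X 0 * X 2 + X 0 * X 3 + X 1 * X 2 + X 1 * X 3 + X 2 * X 3 := by
  have h : Finset.powersetCard 2 (Finset.univ : Finset (Fin 4)) =
    {{0, 1}, {0, 2}, {0, 3}, {1, 2}, {1, 3}, {2, 3}} := by decide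
  rw [esymm, h]
  repeat rw [Finset.sum_insert (by decide)]
  rw [Finset.sum_singleton]
  repeat rw [Finset.prod_pair (by decide)]
  ring

theorem esymm_fin_four_three : esymm (Fin 4) R 3 =
    X 0 * X 1 * X 2 + X 0 * X 1 * X 3 + X 0 * X 2 * X 3 + X 1 * X 2 * X 3 := by
  have h : Finset.powersetCard 3 (Finset.univ : Finset (Fin 4)) =
    {{0, 1, 2}, {0, 1, 3}, {0, 2, 3}, {1, 2, 3}} := by decide
  rw [esymm, h]
  repeat rw [Finset.sum_insert (by decide)]
  rw [Finset.sum_singleton]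
  repeat rw [Finset.prod_insert (by decide)]
  repeat rw [Finset.prod_singleton]
  ring

theorem esymm_fin_four_four : esymm (Fin 4) R 4 = X 0 * X 1 * X 2 * X 3 := by
  have h : Finset.powersetCard 4 (Finset.univ : Finset (Fin 4)) = {Finset.univ} := by decide
  rw [esymm, h, Finset.sum_singleton, Fin.prod_univ_four]

end

variable {K : Type*} [Field K]

/-- The general symmetric quartic form in four variables. -/
noncomputable def symmetricForm (p q r t u : K) : MvPolynomial (Fin 4) K :=
  C p * esymm (Fin 4) K 1 ^ 4 + C q * (esymm (Fin 4) K 1 ^ 2 * esymm (Fin 4) K 2) +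
    C r * (esymm (Fin 4) K 1 * esymm (Fin 4) K 3) + C t * esymm (Fin 4) K 4 +
    C u * esymm (Fin 4) K 2 ^ 2

theorem isHomogeneous_esymm (σ : Type*) [Fintype σ] (n : ℕ) :
    (esymm σ K n).IsHomogeneous n := by
  classical
  rw [esymm]
  refine IsHomogeneous.sum _ _ _ fun s hs => ?_
  have := IsHomogeneous.prod s (fun i => (X i : MvPolynomial σ K)) (fun _ => 1)
    (fun i _ => isHomogeneous_X K i)
  simpa [(Finset.mem_powersetCard.mp hs).2] using this

theorem symmetricForm_isHomogeneous (p q r t u : K) :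
    (symmetricForm p q r t u).IsHomogeneous 4 := by
  have e := isHomogeneous_esymm (K := K) (Fin 4)
  refine ((((?_ : IsHomogeneous _ 4).add ?_).add ?_).add ?_).add ?_
  · exact ((e 1).pow 4).C_mul p
  · exact (((e 1).pow 2).mul (e 2)).C_mul q
  · exact ((e 1).mul (e 3)).C_mul r
  · exact (e 4).C_mul t
  · exact ((e 2).pow 2).C_mul u

theorem symmetricForm_isSymmetric (p q r t u : K) : (symmetricForm p q r t u).IsSymmetric := by
  intro e
  simp [symmetricForm, rename_esymm, -esymm_one]

/-- By the fundamental theorem on symmetric polynomials, `F` is a polynomial in the `σᵢ`. Its part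
of degree 4 involves only the monomials of weight 4, where `σᵢ` has weight `i`; these correspond to
the five partitions of 4. -/
theorem exists_eq_symmetricForm {F : MvPolynomial (Fin 4) K} (hF : F.IsHomogeneous 4)
    (hs : F.IsSymmetric) : ∃ p q r t u : K, F = symmetricForm p q r t u := by
  obtain ⟨P, hP⟩ := esymmAlgHom_surjective (σ := Fin 4) K (n := 4) (by simp) ⟨F, hs⟩
  have hP' : aeval (fun i : Fin 4 => esymm (Fin 4) K (i + 1)) P = F := by
    rw [← esymmAlgHom_apply, hP]
  have key : ∀ Q : MvPolynomial (Fin 4) K, ∃ p q r t u : K, homogeneousComponent 4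
      (aeval (fun i : Fin 4 => esymm (Fin 4) K (i + 1)) Q) = symmetricForm p q r t u := by
    intro Q
    induction Q using MvPolynomial.induction_on' with
    | monomial d c =>
      have hd : (aeval (fun i : Fin 4 => esymm (Fin 4) K (i + 1)) (monomial d c)) =
          C c * (esymm (Fin 4) K 1 ^ d 0 * esymm (Fin 4) K 2 ^ d 1 * esymm (Fin 4) K 3 ^ d 2 *
            esymm (Fin 4) K 4 ^ d 3) := by
        rw [aeval_monomial, algebraMap_eq, Finsupp.prod_fintype _ _ (by simp),
          Fin.prod_univ_four]
        rfl
      have e := isHomogeneous_esymm (K := K) (Fin 4)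
      have hh := (((((e 1).pow (d 0)).mul ((e 2).pow (d 1))).mul ((e 3).pow (d 2))).mul
        ((e 4).pow (d 3))).C_mul c
      rw [hd, homogeneousComponent_of_mem hh]
      split_ifs with h4
      · have : (d 0 = 4 ∧ d 1 = 0 ∧ d 2 = 0 ∧ d 3 = 0) ∨ (d 0 = 2 ∧ d 1 = 1 ∧ d 2 = 0 ∧ d 3 = 0) ∨
          (d 0 = 1 ∧ d 1 = 0 ∧ d 2 = 1 ∧ d 3 = 0) ∨ (d 0 = 0 ∧ d 1 = 0 ∧ d 2 = 0 ∧ d 3 = 1) ∨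
          (d 0 = 0 ∧ d 1 = 2 ∧ d 2 = 0 ∧ d 3 = 0) := by
          have h2 : d 2 ≤ 1 := by omega
          have h3 : d 3 ≤ 1 := by omega
          interval_cases d 2 <;> interval_cases d 3 <;> omega
        rcases this with ⟨a, b, c', d'⟩ | ⟨a, b, c', d'⟩ | ⟨a, b, c', d'⟩ | ⟨a, b, c', d'⟩ |
          ⟨a, b, c', d'⟩
        · exact ⟨c, 0, 0, 0, 0, by simp [a, b, c', d', symmetricForm]⟩
        · exact ⟨0, c, 0, 0, 0, by simp [a, b, c', d', symmetricForm]⟩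
        · exact ⟨0, 0, c, 0, 0, by simp [a, b, c', d', symmetricForm]⟩
        · exact ⟨0, 0, 0, c, 0, by simp [a, b, c', d', symmetricForm]⟩
        · exact ⟨0, 0, 0, 0, c, by simp [a, b, c', d', symmetricForm]⟩
      · exact ⟨0, 0, 0, 0, 0, by simp [symmetricForm]⟩
    | add Q₁ Q₂ h₁ h₂ =>
      obtain ⟨p, q, r, t, u, h⟩ := h₁
      obtain ⟨p', q', r', t', u', h'⟩ := h₂
      refine ⟨p + p', q + q', r + r', t + t', u + u', ?_⟩
      rw [map_add, map_add, h, h']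
      simp only [symmetricForm, C_add]
      ring
  obtain ⟨p, q, r, t, u, h⟩ := key P
  exact ⟨p, q, r, t, u, by rw [← h, hP', homogeneousComponent_eq_self hF]⟩

theorem family_eq_symmetricForm (β : K) : family β = symmetricForm 0 0 0 1 β := by
  simp [family, symmetricForm]

/-- The sum of the coordinates of a vector. -/
def e1 (v : Fin 4 → K) : K := v 0 + v 1 + v 2 + v 3

/-- The second elementary symmetric function of the coordinates of a vector. -/
def e2 (v : Fin 4 → K) : K :=
  v 0 * v 1 + v 0 * v 2 + v 0 * v 3 + v 1 * v 2 + v 1 * v 3 + v 2 * v 3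

/-- The third elementary symmetric function of the coordinates of a vector. -/
def e3 (v : Fin 4 → K) : K :=
  v 0 * v 1 * v 2 + v 0 * v 1 * v 3 + v 0 * v 2 * v 3 + v 1 * v 2 * v 3

/-- The fourth elementary symmetric function of the coordinates of a vector. -/
def e4 (v : Fin 4 → K) : K := v 0 * v 1 * v 2 * v 3

/-- The equations for a vector to represent a singular point of a symmetric quartic in
characteristic two: the last condition says that every coordinate is a root of one cubic. -/
def IsSingularVector (p q r t u : K) (v : Fin 4 → K) : Prop :=
  p * e1 v ^ 4 + q * (e1 v ^ 2 * e2 v) + r * (e1 v * e3 v) + t * e4 v + u * e2 v ^ 2 = 0 ∧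
  ∀ i, t * v i ^ 3 + (r + t) * e1 v * v i ^ 2 + ((q + r) * e1 v ^ 2 + t * e2 v) * v i +
    (q * e1 v ^ 3 + r * (e3 v + e1 v * e2 v) + t * e3 v) = 0

theorem IsSingularVector.smul {p q r t u : K} {v : Fin 4 → K} (h : IsSingularVector p q r t u v)
    (c : K) : IsSingularVector p q r t u (c • v) := by
  refine ⟨?_, fun i => ?_⟩
  · have := h.1
    simp only [e1, e2, e3, e4, Pi.smul_apply, smul_eq_mul] at this ⊢
    linear_combination c ^ 4 * this
  · have := h.2 i
    simp only [e1, e2, e3, Pi.smul_apply, smul_eq_mul] at this ⊢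
    linear_combination c ^ 3 * this

theorem eval_symmetricForm (p q r t u : K) (v : Fin 4 → K) : eval v (symmetricForm p q r t u) =
    p * e1 v ^ 4 + q * (e1 v ^ 2 * e2 v) + r * (e1 v * e3 v) + t * e4 v + u * e2 v ^ 2 := by
  simp [symmetricForm, esymm_fin_four_one, esymm_fin_four_two, esymm_fin_four_three,
    esymm_fin_four_four, e1, e2, e3, e4, -esymm_one]

/-- The derivative of `σₖ` by `xᵢ` is `σₖ₋₁ - xᵢσₖ₋₂ + xᵢ²σₖ₋₃ - ⋯`, so `i` enters only through `v
i`. The squares `σ₁⁴` and `σ₂²` have zero derivative in characteristic 2, hence `p` and `u`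
disappear. -/
theorem eval_pderiv_symmetricForm [CharP K 2] (p q r t u : K) (v : Fin 4 → K) (i : Fin 4) :
    eval v (pderiv i (symmetricForm p q r t u)) =
    t * v i ^ 3 + (r + t) * e1 v * v i ^ 2 + ((q + r) * e1 v ^ 2 + t * e2 v) * v i +
    (q * e1 v ^ 3 + r * (e3 v + e1 v * e2 v) + t * e3 v) := by
  have h2 : (2 : K) = 0 := CharTwo.two_eq_zero
  have : eval v (pderiv i (symmetricForm p q r t u)) = 4 * p * e1 v ^ 3 +
      q * (2 * e1 v * e2 v + e1 v ^ 2 * (e1 v - v i)) +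
      r * (e3 v + e1 v * (e2 v - v i * e1 v + v i ^ 2)) +
      t * (e3 v - v i * e2 v + v i ^ 2 * e1 v - v i ^ 3) + 2 * u * e2 v * (e1 v - v i) := by
    rw [symmetricForm, esymm_fin_four_one, esymm_fin_four_two, esymm_fin_four_three,
      esymm_fin_four_four]
    fin_cases i <;>
    · simp [pderiv_X, e1, e2, e3]
      ring
  rw [this]
  linear_combination (2 * p * e1 v ^ 3 + q * e1 v * e2 v - q * e1 v ^ 2 * v i -
    r * e1 v ^ 2 * v i - t * v i * e2 v - t * v i ^ 3 + u * e2 v * (e1 v - v i)) * h2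

theorem mem_singularPoints_iff [CharP K 2] (p q r t u : K) (x : ℙ K (Fin 4 → K)) :
    x ∈ singularPoints (symmetricForm p q r t u) ↔ IsSingularVector p q r t u x.rep := by
  simp only [singularPoints, Set.mem_ofPred_eq, eval_symmetricForm, eval_pderiv_symmetricForm,
    IsSingularVector]

theorem mk_mem_singularPoints_iff [CharP K 2] (p q r t u : K) (v : Fin 4 → K) (hv : v ≠ 0) :
    Projectivization.mk K v hv ∈ singularPoints (symmetricForm p q r t u) ↔
      IsSingularVector p q r t u v := by
  rw [mem_singularPoints_iff]
  obtain ⟨a, ha⟩ := Projectivization.exists_smul_eq_mk_rep K v hv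
  rw [← ha]
  refine ⟨fun h => ?_, fun h => h.smul _⟩
  have := h.smul (↑a⁻¹ : K)
  rwa [Units.smul_def, smul_smul, Units.inv_mul, one_smul] at this

end SymmetricQuartic
-- Singular vectors with two equal coordinates.
namespace SymmetricQuartic
open MvPolynomial

section
variable {K : Type*}

/-- The vector with coordinates `y` in place `i`, `z` in place `j`, and `x` elsewhere. -/
def pattern (x y z : K) (i j : Fin 4) : Fin 4 → K :=
  fun k => if k = i then y else if k = j then z else x

/-- The vector with coordinates `x + 1` in place `i` and `x` elsewhere. -/
def triplePattern [Add K] [One K] (x : K) (i : Fin 4) : Fin 4 → K := fun k => if k = i then x + 1 else x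

theorem pattern_right (x y : K) {i j : Fin 4} (hij : i ≠ j) :
    pattern x y x i j = pattern x x y j i := by
  ext k
  simp only [pattern]
  split_ifs <;> simp_all

theorem pattern_eq_triplePattern [Add K] [One K] (x : K) {i j : Fin 4} (hij : i ≠ j) :
    pattern x x (x + 1) i j = triplePattern x j := by
  ext k
  simp only [pattern, triplePattern]
  split_ifs <;> simp_all

theorem exists_eq_pattern {v : Fin 4 → K} {k l : Fin 4} (hkl : k ≠ l) (h : v k = v l) :
    ∃ x y z i j, i ≠ j ∧ v = pattern x y z i j := by
  have : ∀ k l : Fin 4, k ≠ l → ∃ i j : Fin 4, i ≠ j ∧ ∀ m, m = i ∨ m = j ∨ m = k ∨ m = l := by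
    decide
  obtain ⟨i, j, hij, hm⟩ := this k l hkl
  refine ⟨v k, v i, v j, i, j, hij, funext fun m => ?_⟩
  simp only [pattern]
  split_ifs with h1 h2
  · rw [h1]
  · rw [h2]
  · rcases hm m with rfl | rfl | rfl | rfl <;> simp_all

end

variable {K : Type*} [Field K]

theorem e_pattern [CharP K 2] (x y z : K) {i j : Fin 4} (hij : i ≠ j) :
    e1 (pattern x y z i j) = y + z ∧ e2 (pattern x y z i j) = x ^ 2 + y * z ∧
      e3 (pattern x y z i j) = x ^ 2 * (y + z) ∧ e4 (pattern x y z i j) = x ^ 2 * (y * z) := by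
  have h2 : (2 : K) = 0 := CharTwo.two_eq_zero
  have : e1 (pattern x y z i j) = 2 * x + y + z ∧
      e2 (pattern x y z i j) = x ^ 2 + 2 * x * (y + z) + y * z ∧
      e3 (pattern x y z i j) = x ^ 2 * (y + z) + 2 * x * y * z ∧
      e4 (pattern x y z i j) = x ^ 2 * (y * z) := by
    fin_cases i <;> fin_cases j <;> first
      | exact absurd rfl hij
      | (simp only [e1, e2, e3, e4, pattern]
         refine ⟨?_, ?_, ?_, ?_⟩ <;> (simp; try ring))
  obtain ⟨h1, h3, h4, h5⟩ := this
  refine ⟨?_, ?_, ?_, h5⟩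
  · rw [h1]; linear_combination x * h2
  · rw [h3]; linear_combination x * (y + z) * h2
  · rw [h4]; linear_combination x * y * z * h2

/-- The cubic of which all coordinates of `pattern x y z i j` have to be roots. -/
def patternCubic (q r t x y z a : K) : K :=
  t * a ^ 3 + (r + t) * (y + z) * a ^ 2 + ((q + r) * (y + z) ^ 2 + t * (x ^ 2 + y * z)) * a +
    (q * (y + z) ^ 3 + r * (y + z) * (y * z) + t * (x ^ 2 * (y + z)))

theorem isSingularVector_pattern_iff [CharP K 2] (p q r t u x y z : K) {i j : Fin 4}
    (hij : i ≠ j) : IsSingularVector p q r t u (pattern x y z i j) ↔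
      p * (y + z) ^ 4 + q * ((y + z) ^ 2 * (x ^ 2 + y * z)) + r * (x ^ 2 * (y + z) ^ 2) +
        t * (x ^ 2 * (y * z)) + u * (x ^ 2 + y * z) ^ 2 = 0 ∧
      patternCubic q r t x y z x = 0 ∧ patternCubic q r t x y z y = 0 ∧
      patternCubic q r t x y z z = 0 := by
  have h2 : (2 : K) = 0 := CharTwo.two_eq_zero
  obtain ⟨h1, h3, h4, h5⟩ := e_pattern x y z hij
  rw [IsSingularVector, h1, h3, h4, h5]
  refine and_congr ?_ ?_
  · rw [← sub_eq_zero, ← sub_eq_zero (b := (0 : K))]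
    constructor <;> intro h <;> linear_combination h
  have hG : ∀ a, t * a ^ 3 + (r + t) * (y + z) * a ^ 2 +
      ((q + r) * (y + z) ^ 2 + t * (x ^ 2 + y * z)) * a +
      (q * (y + z) ^ 3 + r * (x ^ 2 * (y + z) + (y + z) * (x ^ 2 + y * z)) +
        t * (x ^ 2 * (y + z))) = patternCubic q r t x y z a := fun a => by
    rw [patternCubic]
    linear_combination r * x ^ 2 * (y + z) * h2
  simp only [hG]
  constructor
  · intro h
    have : ∀ i j : Fin 4, ∃ k, k ≠ i ∧ k ≠ j := by decide
    obtain ⟨k, hki, hkj⟩ := this i j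
    have hk := h k
    have hi := h i
    have hj := h j
    simp only [pattern, if_neg hki, if_neg hkj, if_true, if_neg hij.symm] at hk hi hj
    exact ⟨hk, hi, hj⟩
  · rintro ⟨hx, hy, hz⟩ k
    simp only [pattern]
    split_ifs <;> assumption

/-- Four roots of a cubic with leading coefficient `1` are not distinct. -/
theorem exists_eq_of_cubic {b c d : K} {v : Fin 4 → K}
    (h : ∀ i, v i ^ 3 + b * v i ^ 2 + c * v i + d = 0) : ∃ k l, k ≠ l ∧ v k = v l := by
  by_contra! hne
  -- First and second divided differences of the cubic; two second differences differ by `v 2 - v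
  -- 3`.
  have key : ∀ k l, k ≠ l → v k ^ 2 + v k * v l + v l ^ 2 + b * (v k + v l) + c = 0 := by
    intro k l hkl
    refine (mul_eq_zero.mp ?_).resolve_left (sub_ne_zero.mpr (hne k l hkl))
    linear_combination h k - h l
  have key' : ∀ k, k ≠ 0 → k ≠ 1 → v 0 + v 1 + v k + b = 0 := by
    intro k h0 h1
    refine (mul_eq_zero.mp ?_).resolve_left (sub_ne_zero.mpr (hne 1 k h1.symm))
    linear_combination key 0 1 (by decide) - key 0 k h0.symm
  exact hne 2 3 (by decide) (by
    linear_combination key' 2 (by decide) (by decide) - key' 3 (by decide) (by decide))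

/-- Three roots of a polynomial of degree two are not distinct. -/
theorem exists_eq_of_quadratic {a b c : K} (ha : a ≠ 0) {v : Fin 4 → K}
    (h : ∀ i, a * v i ^ 2 + b * v i + c = 0) : ∃ k l, k ≠ l ∧ v k = v l := by
  by_contra! hne
  have key : ∀ k l, k ≠ l → a * (v k + v l) + b = 0 := by
    intro k l hkl
    refine (mul_eq_zero.mp ?_).resolve_left (sub_ne_zero.mpr (hne k l hkl))
    linear_combination h k - h l
  exact hne 1 2 (by decide) (mul_left_cancel₀ ha (by
    linear_combination key 0 1 (by decide) - key 0 2 (by decide)))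

theorem isSingularVector_div_iff {p q r t u : K} (ht : t ≠ 0) {v : Fin 4 → K} :
    IsSingularVector (p / t) (q / t) (r / t) 1 (u / t) v ↔ IsSingularVector p q r t u v := by
  refine and_congr ?_ (forall_congr' fun i => ?_)
  · rw [← mul_eq_zero_iff_left ht]
    field_simp
  · rw [← mul_eq_zero_iff_left ht]
    field_simp

/-! ### Counting projective points by normalized vectors. -/

section Projective

theorem exists_normalized_vector [CharP K 2] {p q r t u : K} {x : ℙ K (Fin 4 → K)}
    (hx : x ∈ singularPoints (symmetricForm p q r t u)) :
    ∃ v, ∃ hv : v ≠ 0, Projectivization.mk K v hv = x ∧ IsSingularVector p q r t u v ∧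
      (e1 v = 0 ∨ e1 v = 1) := by
  rw [mem_singularPoints_iff] at hx
  by_cases h : e1 x.rep = 0
  · exact ⟨x.rep, x.rep_nonzero, x.mk_rep, hx, Or.inl h⟩
  · refine ⟨(e1 x.rep)⁻¹ • x.rep, smul_ne_zero (inv_ne_zero h) x.rep_nonzero, ?_, hx.smul _, ?_⟩
    · conv_rhs => rw [← x.mk_rep]
      rw [Projectivization.mk_eq_mk_iff']
      exact ⟨_, rfl⟩
    · right
      rw [← inv_mul_cancel₀ h]
      simp only [e1, Pi.smul_apply, smul_eq_mul]
      ring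

/-- A point off the plane `L = 0` has exactly one representative with `L = 1`, so counting such
points amounts to counting vectors. -/
theorem mk_injective_of_map_eq_one {L : (Fin 4 → K) →ₗ[K] K} {v w : Fin 4 → K} {hv : v ≠ 0}
    {hw : w ≠ 0} (hLv : L v = 1) (hLw : L w = 1)
    (h : Projectivization.mk K v hv = Projectivization.mk K w hw) : v = w := by
  obtain ⟨a, rfl⟩ := (Projectivization.mk_eq_mk_iff' K v w hv hw).mp h
  rw [map_smul, hLw, smul_eq_mul, mul_one] at hLv
  rw [hLv, one_smul]

theorem ne_zero_of_map_eq_one {L : (Fin 4 → K) →ₗ[K] K} {v : Fin 4 → K} (h : L v = 1) :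
    v ≠ 0 := by
  rintro rfl
  simp at h

theorem infinite_singularPoints [Infinite K] [CharP K 2] {p q r t u : K} (φ : K → Fin 4 → K)
    (hφ : Function.Injective φ) (L : (Fin 4 → K) →ₗ[K] K) (hL : ∀ y, L (φ y) = 1)
    (hs : ∀ y, IsSingularVector p q r t u (φ y)) :
    (singularPoints (symmetricForm p q r t u)).Infinite := by
  refine Set.infinite_of_injective_forall_mem
    (f := fun y => Projectivization.mk K (φ y) (ne_zero_of_map_eq_one (hL y))) ?_ ?_
  · intro y z h
    exact hφ (mk_injective_of_map_eq_one (hL y) (hL z) h)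
  · intro y
    exact (mk_mem_singularPoints_iff _ _ _ _ _ _ _).mpr (hs y)

theorem ncard_le_card {S : Set (ℙ K (Fin 4 → K))} (s : Finset (Fin 4 → K))
    (h : ∀ x ∈ S, ∃ v ∈ s, ∃ hv : v ≠ 0, Projectivization.mk K v hv = x) :
    S.ncard ≤ s.card := by
  choose! f hf hf0 hfx using h
  rw [← Set.ncard_coe_finset]
  refine Set.ncard_le_ncard_of_injOn f hf ?_ s.finite_toSet
  intro x hx y hy hxy
  rw [← hfx x hx, ← hfx y hy]
  congr

theorem ncard_eq_card {S : Set (ℙ K (Fin 4 → K))} (s : Finset (Fin 4 → K))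
    (L : (Fin 4 → K) →ₗ[K] K) (hL : ∀ v ∈ s, L v = 1)
    (hS : ∀ v ∈ s, ∀ hv : v ≠ 0, Projectivization.mk K v hv ∈ S)
    (h : ∀ x ∈ S, ∃ v ∈ s, ∃ hv : v ≠ 0, Projectivization.mk K v hv = x) :
    S.ncard = s.card := by
  rw [← Set.ncard_coe_finset]
  symm
  refine Set.ncard_congr (fun v hv => Projectivization.mk K v (ne_zero_of_map_eq_one (hL v hv)))
    ?_ ?_ ?_
  · exact fun v hv => hS v hv _
  · exact fun v w hv hw hvw => mk_injective_of_map_eq_one (hL v hv) (hL w hw) hvw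
  · intro x hx
    obtain ⟨v, hv, hv0, rfl⟩ := h x hx
    exact ⟨v, hv, rfl⟩

end Projective

/-- The linear form `σ₁`. -/
def sumForm (K : Type*) [Field K] : (Fin 4 → K) →ₗ[K] K := ∑ k, LinearMap.proj k

theorem sumForm_apply (v : Fin 4 → K) : sumForm K v = e1 v := by
  simp [sumForm, Fin.sum_univ_four, e1]

/-- Conditions for a vector with two equal coordinates and `σ₁ = 1` to be singular, when the
coefficient of `σ₄` is `1`. -/
theorem isSingularVector_pattern_iff_of_add_eq_one [CharP K 2] (p q r u x y z : K) {i j : Fin 4}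
    (hij : i ≠ j) (hyz : y + z = 1) : IsSingularVector p q r 1 u (pattern x y z i j) ↔
      p + x ^ 4 + r * x ^ 2 + u * (x ^ 2 + y * z) ^ 2 = 0 ∧ x ^ 2 = q ∧
        (x = r ∨ x = y ∨ x = z) := by
  have h2 : (2 : K) = 0 := CharTwo.two_eq_zero
  obtain rfl : z = y + 1 := by linear_combination hyz - y * h2
  rw [isSingularVector_pattern_iff _ _ _ _ _ _ _ _ hij]
  simp only [patternCubic]
  have hs : y + (y + 1) = 1 := by linear_combination y * h2
  simp only [hs]
  constructor
  · rintro ⟨hF, hx, hy, hz⟩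
    -- The difference of the values of the cubic at `y + 1` and `y` is `x² + q`. Once it vanishes,
    -- the cubic in `a` is `(a + r)(a + y)(a + z)`, and only its value at `x` carries further
    -- information.
    obtain rfl : x ^ 2 = q := by
      linear_combination hz - hy - (q + r + r * y + 2 * y ^ 2 + 3 * y + 1) * h2
    refine ⟨by linear_combination hF - x ^ 2 * (y * (y + 1)) * h2, rfl, ?_⟩
    have : (x + r) * ((x + y) * (x + (y + 1))) = 0 := by
      linear_combination hx - (x ^ 3 + x ^ 2 - x ^ 2 * y - r * x * y) * h2
    rcases mul_eq_zero.mp this with h | h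
    · left; linear_combination h - r * h2
    rcases mul_eq_zero.mp h with h | h
    · right; left; linear_combination h - y * h2
    · right; right; linear_combination h - (y + 1) * h2
  · rintro ⟨hF, rfl, hx⟩
    have h : (x - r) * ((x - y) * (x - (y + 1))) = 0 := by
      rcases hx with rfl | rfl | rfl <;> ring
    refine ⟨by linear_combination hF + x ^ 2 * (y * (y + 1)) * h2, ?_, ?_, ?_⟩
    · linear_combination h + (x ^ 3 + (r + 2 + y) * x ^ 2 - x * r * y + r * y + r * y ^ 2) * h2
    · linear_combination (y ^ 3 + y ^ 2 + r * y ^ 2 + r * y + x ^ 2 * y + x ^ 2) * h2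
    · linear_combination (y ^ 3 + y ^ 2 + r * y ^ 2 + r * y + x ^ 2 * y + x ^ 2 + 2 * y ^ 2 +
        3 * y + 1 + r * y + r + x ^ 2) * h2

end SymmetricQuartic
-- Bounds for the number of singular points, and their sharpness.
namespace SymmetricQuartic
open MvPolynomial

variable {K : Type*} [Field K]

theorem add_one_eq_of_add_eq_one [CharP K 2] {y z : K} (h : y + z = 1) : z = y + 1 := by
  linear_combination h - y * CharTwo.two_eq_zero (R := K)

theorem eq_of_sq_eq_sq [CharP K 2] {x y : K} (h : x ^ 2 = y ^ 2) : x = y :=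
  CharTwo.sq_injective h

theorem eq_or_eq_add_one [CharP K 2] {y z : K} (h : y ^ 2 + y = z ^ 2 + z) :
    y = z ∨ y = z + 1 := by
  have h2 : (2 : K) = 0 := CharTwo.two_eq_zero
  have : (y - z) * (y - (z + 1)) = 0 := by linear_combination h + (z ^ 2 - y * z - y + z) * h2
  rcases mul_eq_zero.mp this with h | h
  · exact Or.inl (sub_eq_zero.mp h)
  · exact Or.inr (sub_eq_zero.mp h)

theorem e1_triplePattern [CharP K 2] (x : K) (i : Fin 4) : e1 (triplePattern x i) = 1 := by
  have h2 : (2 : K) = 0 := CharTwo.two_eq_zero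
  fin_cases i <;> simp [e1, triplePattern] <;> linear_combination 2 * x * h2

theorem exists_pattern_of_isSingularVector {p q r u : K} {v : Fin 4 → K}
    (h : IsSingularVector p q r 1 u v) : ∃ x y z i j, i ≠ j ∧ v = pattern x y z i j := by
  obtain ⟨k, l, hkl, hv⟩ := exists_eq_of_cubic (v := v) (b := (r + 1) * e1 v)
    (c := (q + r) * e1 v ^ 2 + 1 * e2 v) (d := q * e1 v ^ 3 + r * (e3 v + e1 v * e2 v) + 1 * e3 v)
    (fun i => by linear_combination h.2 i)
  exact exists_eq_pattern hkl hv

/-- The normal form of a singular vector with `σ₁ = 0`, if the coefficient of `σ₄` is `1`. -/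
theorem eq_zero_or_of_e1_eq_zero [CharP K 2] {p q r u : K} {v : Fin 4 → K} (hv : v ≠ 0)
    (h : IsSingularVector p q r 1 u v) (h1 : e1 v = 0) :
    u = 0 ∧ ∃ T ∈ Finset.powersetCard 2 (Finset.univ : Finset (Fin 4)), ∃ c : K, c ≠ 0 ∧
      v = c • fun k => if k ∈ T then 1 else 0 := by
  have h2 : (2 : K) = 0 := CharTwo.two_eq_zero
  obtain ⟨x, y, z, i, j, hij, rfl⟩ := exists_pattern_of_isSingularVector h
  rw [(e_pattern x y z hij).1] at h1
  obtain rfl : z = y := by linear_combination h1 - y * h2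
  obtain ⟨hF, hx, -, -⟩ := (isSingularVector_pattern_iff _ _ _ _ _ _ _ _ hij).mp h
  simp only [patternCubic, h1] at hx
  -- Hence the point has two coordinates 0 and two equal nonzero ones; there `σ₄ = 0` and `σ₂ ≠ 0`,
  -- so `F = 0` forces `u = 0`.
  have hxz : x * z ^ 2 = 0 := by linear_combination hx - x ^ 3 * h2
  simp only [h1] at hF
  rcases mul_eq_zero.mp hxz with rfl | hz
  · have hz : z ≠ 0 := by
      rintro rfl
      exact hv (by ext k; simp [pattern])
    refine ⟨?_, {i, j}, ?_, z, hz, ?_⟩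
    · refine (mul_eq_zero.mp ?_).resolve_right (pow_ne_zero 4 hz)
      linear_combination hF
    · simp [Finset.mem_powersetCard, Finset.card_pair hij]
    · ext k
      simp only [pattern, Pi.smul_apply, Finset.mem_insert, Finset.mem_singleton, smul_eq_mul]
      split_ifs <;> simp_all
  · obtain rfl : z = 0 := by simpa using hz
    have hx : x ≠ 0 := by
      rintro rfl
      exact hv (by ext k; simp [pattern])
    refine ⟨?_, {i, j}ᶜ, ?_, x, hx, ?_⟩
    · refine (mul_eq_zero.mp ?_).resolve_right (pow_ne_zero 4 hx)
      linear_combination hF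
    · rw [Finset.mem_powersetCard_univ, Finset.card_compl, Finset.card_pair hij, Fintype.card_fin]
    · ext k
      simp only [pattern, Pi.smul_apply, Finset.mem_compl, Finset.mem_insert,
        Finset.mem_singleton, smul_eq_mul]
      split_ifs <;> simp_all

theorem exists_sq_add_self_eq [IsAlgClosed K] (w : K) : ∃ y : K, y ^ 2 + y = w := by
  obtain ⟨y, hy⟩ := IsAlgClosed.exists_root
    (Polynomial.X ^ 2 + Polynomial.X - Polynomial.C w : Polynomial K) (by
      have : (Polynomial.X ^ 2 + Polynomial.X - Polynomial.C w : Polynomial K).degree = 2 := by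
        compute_degree!
      rw [this]; decide)
  refine ⟨y, ?_⟩
  simp only [Polynomial.IsRoot, Polynomial.eval_sub, Polynomial.eval_add, Polynomial.eval_pow,
    Polynomial.eval_X, Polynomial.eval_C] at hy
  linear_combination hy

theorem exists_sq_eq [IsAlgClosed K] (w : K) : ∃ y : K, y ^ 2 = w := by
  obtain ⟨y, hy⟩ := IsAlgClosed.exists_pow_nat_eq w (n := 2) (by norm_num)
  exact ⟨y, hy⟩

/-- Singular points of symmetric quartics that contain both `σ₄` and `σ₂²`. -/
theorem exists_pattern_of_mem_singularPoints [CharP K 2] {p q r u x₀ y₀ : K} (hu : u ≠ 0)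
    (hx₀ : x₀ ^ 2 = q) (hy₀ : u * (y₀ ^ 2 + y₀ + x₀ ^ 2) ^ 2 = p + x₀ ^ 4 + r * x₀ ^ 2)
    {P : ℙ K (Fin 4 → K)} (hP : P ∈ singularPoints (symmetricForm p q r 1 u)) :
    ∃ i j, i ≠ j ∧ ∃ hv : pattern x₀ y₀ (y₀ + 1) i j ≠ 0, Projectivization.mk K _ hv = P := by
  have h2 : (2 : K) = 0 := CharTwo.two_eq_zero
  obtain ⟨v, hv, hvP, hs, h0 | h1⟩ := exists_normalized_vector hP
  · exact absurd (eq_zero_or_of_e1_eq_zero hv hs h0).1 hu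
  obtain ⟨x, y, z, i, j, hij, rfl⟩ := exists_pattern_of_isSingularVector hs
  rw [(e_pattern x y z hij).1] at h1
  obtain ⟨hF, hq, hr⟩ := (isSingularVector_pattern_iff_of_add_eq_one _ _ _ _ _ _ _ hij h1).mp hs
  obtain rfl := add_one_eq_of_add_eq_one h1
  obtain rfl : x = x₀ := eq_of_sq_eq_sq (hq.trans hx₀.symm)
  have : (x ^ 2 + y * (y + 1)) ^ 2 = (y₀ ^ 2 + y₀ + x ^ 2) ^ 2 :=
    mul_left_cancel₀ hu (by
      linear_combination hF - hy₀ - (p + x ^ 4 + r * x ^ 2) * h2)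
  rcases eq_or_eq_add_one (y := y) (z := y₀) (by linear_combination eq_of_sq_eq_sq this) with
    rfl | rfl
  · exact ⟨i, j, hij, hv, hvP⟩
  -- The other root `y₀ + 1` only exchanges the two positions.
  · have : pattern x (y₀ + 1) (y₀ + 1 + 1) i j = pattern x y₀ (y₀ + 1) j i := by
      have h3 : y₀ + 1 + 1 = y₀ := by linear_combination h2
      ext k
      simp only [pattern, h3]
      split_ifs <;> simp_all
    rw [this] at hv
    refine ⟨j, i, hij.symm, hv, ?_⟩
    rw [← hvP]
    congr 1
    exact this.symm

theorem card_offDiag_fin_four : (Finset.univ : Finset (Fin 4)).offDiag.card = 12 := by decide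

section
variable [IsAlgClosed K] [CharP K 2]

theorem ncard_singularPoints_le_twelve_of_ne_zero {p q r u : K} (hu : u ≠ 0) :
    (singularPoints (symmetricForm p q r 1 u)).ncard ≤ 12 := by
  classical
  obtain ⟨x₀, hx₀⟩ := exists_sq_eq q
  obtain ⟨w, hw⟩ := exists_sq_eq ((p + x₀ ^ 4 + r * x₀ ^ 2) / u)
  obtain ⟨y₀, hy₀⟩ := exists_sq_add_self_eq (w - x₀ ^ 2)
  have hy : u * (y₀ ^ 2 + y₀ + x₀ ^ 2) ^ 2 = p + x₀ ^ 4 + r * x₀ ^ 2 := by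
    rw [hy₀, sub_add_cancel, hw, mul_div_cancel₀ _ hu]
  refine (ncard_le_card ((Finset.univ : Finset (Fin 4)).offDiag.image
    fun ij => pattern x₀ y₀ (y₀ + 1) ij.1 ij.2) fun P hP => ?_).trans
      (Finset.card_image_le.trans card_offDiag_fin_four.le)
  obtain ⟨i, j, hij, hv, rfl⟩ := exists_pattern_of_mem_singularPoints hu hx₀ hy hP
  exact ⟨_, Finset.mem_image.mpr ⟨(i, j), by simpa using hij, rfl⟩, hv, rfl⟩

/-- The 6 come from `σ₁ = 0`, one for each pair of coordinates. With `σ₁ = 1`, finiteness rules out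
`x = r`, so three coordinates equal `x₀`, which leaves 4 points. -/
theorem ncard_singularPoints_le_ten {p q r : K}
    (hfin : (singularPoints (symmetricForm p q r 1 0)).Finite) :
    (singularPoints (symmetricForm p q r 1 0)).ncard ≤ 10 := by
  classical
  obtain ⟨x₀, hx₀⟩ := exists_sq_eq q
  refine (ncard_le_card
    ((Finset.powersetCard 2 (Finset.univ : Finset (Fin 4))).image
      (fun T => (fun k => if k ∈ T then 1 else 0 : Fin 4 → K)) ∪
      (Finset.univ : Finset (Fin 4)).image (triplePattern x₀)) fun P hP => ?_).trans
      ((Finset.card_union_le _ _).trans (Nat.add_le_add (b := 6) (d := 4)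
        (Finset.card_image_le.trans ?_) (Finset.card_image_le.trans ?_)))
  · obtain ⟨v, hv, hvP, hs, h0 | h1⟩ := exists_normalized_vector hP
    · obtain ⟨-, T, hT, c, hc, rfl⟩ := eq_zero_or_of_e1_eq_zero hv hs h0
      refine ⟨_, Finset.mem_union_left _ (Finset.mem_image_of_mem _ hT), right_ne_zero_of_smul hv,
        ?_⟩
      rw [← hvP, eq_comm, Projectivization.mk_eq_mk_iff']
      exact ⟨c, rfl⟩
    · obtain ⟨x, y, z, i, j, hij, rfl⟩ := exists_pattern_of_isSingularVector hs
      rw [(e_pattern x y z hij).1] at h1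
      obtain ⟨hF, hq, hr⟩ :=
        (isSingularVector_pattern_iff_of_add_eq_one _ _ _ _ _ _ _ hij h1).mp hs
      obtain rfl := add_one_eq_of_add_eq_one h1
      obtain rfl : x = x₀ := eq_of_sq_eq_sq (hq.trans hx₀.symm)
      have key : ∃ k, pattern x y (y + 1) i j = triplePattern x k := by
        rcases hr with rfl | rfl | rfl
        -- For `u = 0` and `x = r` no condition on `y` is left, so a whole line of points is
        -- singular.
        · refine absurd hfin (infinite_singularPoints (fun y => pattern x y (y + 1) 0 1) ?_
            (sumForm K) (fun y => ?_) (fun y => ?_))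
          · intro y z h
            simpa [pattern] using congrFun h 0
          · rw [sumForm_apply, (e_pattern x y (y + 1) (by decide)).1]
            linear_combination y * CharTwo.two_eq_zero (R := K)
          · rw [isSingularVector_pattern_iff_of_add_eq_one _ _ _ _ _ _ _ (by decide)
              (by linear_combination y * CharTwo.two_eq_zero (R := K))]
            exact ⟨by linear_combination hF, hq, Or.inl rfl⟩
        · exact ⟨j, pattern_eq_triplePattern x hij⟩
        · refine ⟨i, ?_⟩
          rw [pattern_right _ _ hij]
          have := pattern_eq_triplePattern (y + 1) hij.symm
          rwa [show y + 1 + 1 = y by linear_combination CharTwo.two_eq_zero (R := K)] at this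
      obtain ⟨k, hk⟩ := key
      refine ⟨_, Finset.mem_union_right _ (Finset.mem_image_of_mem _ (Finset.mem_univ k)),
        hk ▸ hv, ?_⟩
      rw [← hvP]
      congr 1
      exact hk.symm
  · simp [Finset.card_powersetCard, Nat.choose]
  · simp

/-- A symmetric quartic in the span of `σ₁⁴, σ₁²σ₂, σ₂²` is singular along a line. -/
theorem infinite_singularPoints_of_sq {p q u : K} :
    (singularPoints (symmetricForm p q 0 0 u)).Infinite := by
  obtain ⟨ω, hω⟩ := exists_sq_add_self_eq (1 : K)
  have h2 : (2 : K) = 0 := CharTwo.two_eq_zero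
  -- Every point with `σ₁ = σ₂ = 0` is singular. Since `ω` is a primitive cube root of unity, this
  -- conic in the plane `σ₁ = 0` splits into two lines over `𝔽₄`; this is one of them.
  refine infinite_singularPoints (fun b => ![ω * b + ω ^ 2, b, 1, ω ^ 2 * b + ω]) ?_
    (LinearMap.proj 2) (fun y => rfl) (fun b => ?_)
  · intro y z h
    simpa using congrFun h 1
  · have h1 : e1 ![ω * b + ω ^ 2, b, 1, ω ^ 2 * b + ω] = 0 := by
      simp [e1]
      linear_combination (b + 1) * hω + (b + 1) * h2
    have h3 : e2 ![ω * b + ω ^ 2, b, 1, ω ^ 2 * b + ω] = 0 := by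
      simp [e2]
      linear_combination (b ^ 2 + b + ω ^ 2 + ω + 3 + ((ω * b + ω ^ 2) + b + 1) * (b - 1)) * hω +
        (b ^ 2 + b + 2 - ω ^ 3 - ω ^ 2 - ω + ω ^ 3 * b + (ω * b + ω ^ 2) * (b + 1) + b +
          ((ω * b + ω ^ 2) + b + 1) * (-ω * b + ω - 1)) * h2
    simp [IsSingularVector, h1, h3]

/-- The form is `σ₁` times a cubic, so its surface is singular wherever both factors vanish, in
particular at all points `(1 : 1 : y : y)`. -/
theorem infinite_singularPoints_of_dvd {p q r : K} :
    (singularPoints (symmetricForm p q r 0 0)).Infinite := by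
  have h2 : (2 : K) = 0 := CharTwo.two_eq_zero
  refine infinite_singularPoints (fun y => pattern 1 y y 2 3) ?_
    (LinearMap.proj 0) (fun y => ?_) (fun y => ?_)
  · intro y z h
    simpa [pattern] using congrFun h 2
  · simp [pattern]
  · have hy : y + y = 0 := CharTwo.add_self_eq_zero y
    rw [isSingularVector_pattern_iff _ _ _ _ _ _ _ _ (by decide)]
    simp [patternCubic, hy]

/-- If `σ₁ = 0`, then also `σ₂ = σ₃ = 0` and the point is `(1 : 1 : 1 : 1)`. If `σ₁ = 1`, the
derivatives are quadratic in the coordinate, three coordinates agree, and their common value is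
determined by `F = 0`. -/
theorem ncard_singularPoints_le_five {p q r u : K} (hr : r ≠ 0) (hu : u ≠ 0)
    (hfin : (singularPoints (symmetricForm p q r 0 u)).Finite) :
    (singularPoints (symmetricForm p q r 0 u)).ncard ≤ 5 := by
  classical
  have h2 : (2 : K) = 0 := CharTwo.two_eq_zero
  -- If `r + u = 0` this quotient is the default value 0; in that case a point with `σ₁ = 1` yields
  -- infinitely many, against `hfin`.
  obtain ⟨x₀, hx₀⟩ := exists_sq_eq (p / (r + u))
  refine (ncard_le_card (insert (fun _ => 1)
      ((Finset.univ : Finset (Fin 4)).image (triplePattern x₀))) fun P hP => ?_).trans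
      ((Finset.card_insert_le _ _).trans (Nat.add_le_add_right (m := 4)
        (Finset.card_image_le.trans (by simp)) 1))
  obtain ⟨v, hv, hvP, hs, h0 | h1⟩ := exists_normalized_vector hP
  · have hF := hs.1
    have hG := hs.2 0
    simp only [h0] at hF hG
    have he2 : e2 v = 0 := by
      have : u * e2 v ^ 2 = 0 := by linear_combination hF
      simpa [hu] using this
    have he3 : e3 v = 0 := by
      have : r * e3 v = 0 := by linear_combination hG
      simpa [hr] using this
    -- Each coordinate is a root of `∏ (T - v k)`, here reduced to `T⁴ + σ₄`. Squaring is injective,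
    -- so all coordinates agree.
    have h4 : ∀ k, v k ^ 4 = e4 v := by
      have : ∀ k, v k ^ 4 - e1 v * v k ^ 3 + e2 v * v k ^ 2 - e3 v * v k + e4 v = 0 := by
        intro k
        simp only [e1, e2, e3, e4]
        fin_cases k <;> simp <;> ring
      intro k
      have hk := this k
      rw [h0, he2, he3] at hk
      linear_combination hk - e4 v * h2
    have hconst : v = v 0 • fun _ => 1 := by
      ext k
      have : (v k ^ 2) ^ 2 = (v 0 ^ 2) ^ 2 := by linear_combination h4 k - h4 0
      simpa using eq_of_sq_eq_sq (eq_of_sq_eq_sq this)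
    refine ⟨_, Finset.mem_insert_self _ _, fun h => one_ne_zero (congrFun h 0), ?_⟩
    rw [← hvP, eq_comm, Projectivization.mk_eq_mk_iff']
    exact ⟨v 0, hconst.symm⟩
  · obtain ⟨k, l, hkl, hvkl⟩ := exists_eq_of_quadratic (v := v) (a := r) (b := q + r)
      (c := q + r * (e3 v + e2 v)) hr (fun i => by
        have := hs.2 i
        rw [h1] at this
        linear_combination this)
    obtain ⟨x, y, z, i, j, hij, rfl⟩ := exists_eq_pattern hkl hvkl
    rw [(e_pattern x y z hij).1] at h1
    obtain ⟨hF, hx, hy, hz⟩ := (isSingularVector_pattern_iff _ _ _ _ _ _ _ _ hij).mp hs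
    obtain rfl := add_one_eq_of_add_eq_one h1
    simp only [patternCubic, h1] at hF hx hy hz
    have hq : q = 0 := by
      linear_combination hz - hy - (r * y + r) * h2
    subst hq
    have hxy : x = y ∨ x = y + 1 :=
      eq_or_eq_add_one (mul_left_cancel₀ hr (by linear_combination hx - r * (y ^ 2 + y) * h2))
    have hF' : p + (r + u) * x ^ 2 = 0 := by
      rcases hxy with rfl | rfl
      · linear_combination hF - u * (2 * x ^ 4 + 2 * x ^ 3) * h2
      · linear_combination hF - u * (y + 1) ^ 2 * (2 * y ^ 2 + 2 * y) * h2
    have hx₀' : x = x₀ := by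
      by_cases hru : r + u = 0
      · have hp : p = 0 := by rw [hru] at hF'; linear_combination hF'
        subst hp
        refine absurd hfin (infinite_singularPoints (fun x => triplePattern x 0) ?_
            (sumForm K) (fun y => ?_) (fun y => ?_))
        · intro y z h
          simpa [triplePattern] using congrFun h 1
        · rw [sumForm_apply, e1_triplePattern]
        · rw [← pattern_eq_triplePattern y (i := 1) (by decide),
            isSingularVector_pattern_iff _ _ _ _ _ _ _ _ (by decide)]
          have hy : y + (y + 1) = 1 := by linear_combination y * h2
          simp only [patternCubic, hy]
          refine ⟨?_, ?_, ?_, ?_⟩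
          · linear_combination y ^ 2 * hru + u * (2 * y ^ 4 + 2 * y ^ 3) * h2
          · linear_combination r * (y ^ 2 + y) * h2
          · linear_combination r * (y ^ 2 + y) * h2
          · linear_combination r * (y ^ 2 + 2 * y + 1) * h2
      · refine eq_of_sq_eq_sq ?_
        rw [hx₀, eq_div_iff hru]
        linear_combination hF' - p * h2
    have key : ∃ k, pattern x y (y + 1) i j = triplePattern x k := by
      rcases hxy with rfl | rfl
      · exact ⟨j, pattern_eq_triplePattern x hij⟩
      · refine ⟨i, ?_⟩
        rw [pattern_right _ _ hij]
        have := pattern_eq_triplePattern (y + 1) hij.symm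
        rwa [show y + 1 + 1 = y by linear_combination CharTwo.two_eq_zero (R := K)] at this
    obtain ⟨k, hk⟩ := key
    rw [hx₀'] at hk
    refine ⟨_, Finset.mem_insert_of_mem (Finset.mem_image_of_mem _ (Finset.mem_univ k)), ?_, ?_⟩
    · rw [← hk, ← hx₀']; exact hv
    · rw [← hvP]
      congr 1
      rw [← hk, ← hx₀']

theorem ncard_singularPoints_le_twelve {F : MvPolynomial (Fin 4) K} (hF : IsNormalQuartic F)
    (hs : F.IsSymmetric) : (singularPoints F).ncard ≤ 12 := by
  obtain ⟨p, q, r, t, u, rfl⟩ := exists_eq_symmetricForm hF.isHomogeneous hs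
  have hfin := hF.finite_singularPoints
  by_cases ht : t = 0
  · subst ht
    by_cases hr : r = 0
    · subst hr
      exact absurd hfin infinite_singularPoints_of_sq
    by_cases hu : u = 0
    · subst hu
      exact absurd hfin infinite_singularPoints_of_dvd
    exact (ncard_singularPoints_le_five hr hu hfin).trans (by norm_num)
  · have : singularPoints (symmetricForm p q r t u) =
        singularPoints (symmetricForm (p / t) (q / t) (r / t) 1 (u / t)) := by
      ext x
      rw [mem_singularPoints_iff, mem_singularPoints_iff, isSingularVector_div_iff ht]
    rw [this] at hfin ⊢
    by_cases hu : u / t = 0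
    · rw [hu] at hfin ⊢
      exact (ncard_singularPoints_le_ten hfin).trans (by norm_num)
    · exact ncard_singularPoints_le_twelve_of_ne_zero hu

theorem exists_twelve_singularPoints : ∃ F : MvPolynomial (Fin 4) K,
    IsNormalQuartic F ∧ F.IsSymmetric ∧ (singularPoints F).ncard = 12 := by
  classical
  have h2 : (2 : K) = 0 := CharTwo.two_eq_zero
  obtain ⟨ω, hω⟩ := exists_sq_add_self_eq (1 : K)
  have hω0 : ω ≠ 0 := by rintro rfl; simp at hω
  have hω1 : ω + 1 ≠ 0 := fun h => by
    have : (1 : K) = 0 := by linear_combination ω * h - hω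
    exact one_ne_zero this
  have hωω : ω + (ω + 1) = 1 := by linear_combination ω * h2
  -- Here `x = 0 = r`, so the condition on `x` holds for any `y`, and `F = 0` becomes `(y² + y)² =
  -- 1`. The singular points are the 12 arrangements of `(0, 0, ω, ω + 1)`, distinct because `0`,
  -- `ω`, `ω + 1` are.
  have hcard : (singularPoints (symmetricForm (1 : K) 0 0 1 1)).ncard = 12 := by
    rw [← card_offDiag_fin_four, ← Finset.card_image_of_injOn (s := Finset.univ.offDiag)
      (f := fun ij : Fin 4 × Fin 4 => pattern 0 ω (ω + 1) ij.1 ij.2)]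
    · refine ncard_eq_card _ (sumForm K) ?_ ?_ fun P hP => ?_
      · simp only [Finset.mem_image, forall_exists_index, and_imp]
        rintro _ ⟨i, j⟩ hij rfl
        rw [sumForm_apply, (e_pattern _ _ _ (Finset.mem_offDiag.mp hij).2.2).1, hωω]
      · simp only [Finset.mem_image, forall_exists_index, and_imp]
        rintro _ ⟨i, j⟩ hij rfl hv
        rw [mk_mem_singularPoints_iff, isSingularVector_pattern_iff_of_add_eq_one _ _ _ _ _ _ _
          (Finset.mem_offDiag.mp hij).2.2 hωω]
        refine ⟨?_, by simp, by simp⟩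
        linear_combination (ω ^ 2 + ω + 1) * hω + h2
      · obtain ⟨i, j, hij, hv, rfl⟩ := exists_pattern_of_mem_singularPoints (x₀ := 0) (y₀ := ω)
          one_ne_zero (by simp) (by rw [hω]; simp) hP
        exact ⟨_, Finset.mem_image.mpr ⟨(i, j), by simpa using hij, rfl⟩, hv, rfl⟩
    · rintro ⟨i, j⟩ hij ⟨i', j'⟩ hij' h
      have hij : i ≠ j := by simpa using hij
      have hij' : i' ≠ j' := by simpa using hij'
      have hi := congrFun h i
      have hj := congrFun h j
      have hne : ω ≠ ω + 1 := by simp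
      simp only [pattern] at hi hj
      grind
  refine ⟨symmetricForm 1 0 0 1 1, ⟨symmetricForm_isHomogeneous _ _ _ _ _, ?_, ?_⟩,
    symmetricForm_isSymmetric _ _ _ _ _, hcard⟩
  · intro h
    have := eval_symmetricForm (1 : K) 0 0 1 1 ![1, 0, 0, 0]
    rw [h] at this
    simp [e1, e2, e3, e4] at this
  -- `Set.ncard` is 0 on infinite sets, so the count itself gives finiteness.
  · exact Set.finite_of_ncard_ne_zero (by rw [hcard]; norm_num)

end

/-! ### The singular points of the family `σ₄ + βσ₂²`. -/

theorem mem_singularPoints_family_iff [CharP K 2] {β : K} (hβ : β ≠ 0) (P : ℙ K (Fin 4 → K)) :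
    P ∈ singularPoints (family β) ↔
      ∃ i, ∃ hv : triplePattern (0 : K) i ≠ 0, Projectivization.mk K _ hv = P := by
  rw [family_eq_symmetricForm]
  constructor
  · intro hP
    -- Since `x₀ = y₀`, the 12 arrangements collapse to the 4 coordinate points.
    obtain ⟨i, j, hij, hv, rfl⟩ := exists_pattern_of_mem_singularPoints (x₀ := 0) (y₀ := 0)
      hβ (by simp) (by simp) hP
    refine ⟨j, ?_⟩
    have := pattern_eq_triplePattern (0 : K) hij
    exact ⟨this ▸ hv, by congr 1; exact this.symm⟩
  · rintro ⟨i, hv, rfl⟩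
    obtain ⟨k, hk⟩ : ∃ k, k ≠ i := exists_ne i
    rw [mk_mem_singularPoints_iff, ← pattern_eq_triplePattern (0 : K) hk,
      isSingularVector_pattern_iff_of_add_eq_one _ _ _ _ _ _ _ hk (by simp)]
    simp

theorem ncard_singularPoints_family [CharP K 2] {β : K} (hβ : β ≠ 0) :
    (singularPoints (family β)).ncard = 4 := by
  classical
  have : ((Finset.univ : Finset (Fin 4)).image (triplePattern (0 : K))).card = 4 := by
    rw [Finset.card_image_of_injective, Finset.card_univ, Fintype.card_fin]
    intro i j h
    have := congrFun h i
    by_contra hij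
    simp [triplePattern, hij] at this
  refine (ncard_eq_card _ (sumForm K) ?_ ?_ ?_).trans this
  · simp only [Finset.mem_image, forall_exists_index, and_imp]
    rintro _ i - rfl
    rw [sumForm_apply, e1_triplePattern]
  · simp only [Finset.mem_image, forall_exists_index, and_imp]
    rintro _ i - rfl hv
    exact (mem_singularPoints_family_iff hβ _).mpr ⟨i, hv, rfl⟩
  · intro P hP
    obtain ⟨i, hv, h⟩ := (mem_singularPoints_family_iff hβ _).mp hP
    exact ⟨_, Finset.mem_image_of_mem _ (Finset.mem_univ i), hv, h⟩

end SymmetricQuartic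
-- Artin–Schreier equations over power series rings.
namespace SymmetricQuartic

section ArtinSchreier
open MvPowerSeries

variable {σ K : Type*} [Field K] [CharP K 2]

theorem mvPowerSeries_two_eq_zero : (2 : MvPowerSeries σ K) = 0 := by
  have : (2 : MvPowerSeries σ K) = C (2 : K) := (map_ofNat C 2).symm
  rw [this, CharTwo.two_eq_zero, map_zero]

omit [CharP K 2] in
theorem coeff_pow_eq_zero_of_degree_lt {s : MvPowerSeries σ K} (hs : constantCoeff s = 0)
    {d : σ →₀ ℕ} {n : ℕ} (h : d.degree < n) : coeff d (s ^ n) = 0 := by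
  refine coeff_of_lt_order ((Nat.cast_lt.mpr h).trans_le ?_)
  have h1 : 1 ≤ s.order := one_le_order_iff_constCoeff_eq_zero.mpr hs
  calc (n : ℕ∞) = n • 1 := by simp
    _ ≤ n • s.order := by gcongr
    _ ≤ _ := le_order_pow n

/-- The solution is `s + s² + s⁴ + s⁸ + ⋯`, convergent because `s` has no constant term; the sum
telescopes since squaring is additive. -/
theorem exists_sq_add_self_eq_mvPowerSeries {s : MvPowerSeries σ K} (hs : constantCoeff s = 0) :
    ∃ u : MvPowerSeries σ K, constantCoeff u = 0 ∧ u ^ 2 + u = s := by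
  classical
  have h2 := mvPowerSeries_two_eq_zero (σ := σ) (K := K)
  let S : ℕ → MvPowerSeries σ K := fun n => ∑ k ∈ Finset.range n, s ^ 2 ^ k
  have hS : ∀ n, S n ^ 2 + S n = s ^ 2 ^ n + s := by
    intro n
    induction n with
    | zero => simp only [S, Finset.range_zero, Finset.sum_empty]; linear_combination -s * h2
    | succ n ih =>
      have : S (n + 1) = S n + s ^ 2 ^ n := Finset.sum_range_succ _ _
      rw [this, pow_succ 2 n, pow_mul]
      linear_combination ih + (S n + 1) * s ^ 2 ^ n * h2
  -- Coefficients in degree `d` are stable from this partial sum on, since `s ^ 2 ^ n` has order at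
  -- least `2 ^ n > n`.
  let u : MvPowerSeries σ K := fun d => coeff d (S (d.degree + 1))
  have hu : ∀ d n, d.degree < n → coeff d u = coeff d (S n) := by
    intro d n hn
    induction n, hn using Nat.le_induction with
    | base => rfl
    | succ n hn ih =>
      have : S (n + 1) = S n + s ^ 2 ^ n := Finset.sum_range_succ _ _
      rw [this, map_add, ← ih, coeff_pow_eq_zero_of_degree_lt hs
        ((Nat.lt_of_succ_le hn).trans Nat.lt_two_pow_self), add_zero]
  refine ⟨u, ?_, ?_⟩
  · rw [← coeff_zero_eq_constantCoeff_apply, hu 0 1 (by simp)]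
    simpa [S] using hs
  · ext d
    have hd : coeff d (u ^ 2 + u) = coeff d (S (d.degree + 1) ^ 2 + S (d.degree + 1)) := by
      rw [map_add, map_add, hu d _ (Nat.lt_succ_self _), sq, sq, coeff_mul, coeff_mul]
      congr 1
      refine Finset.sum_congr rfl fun ab hab => ?_
      have h := congrArg Finsupp.degree (Finset.HasAntidiagonal.mem_antidiagonal.mp hab)
      rw [map_add] at h
      rw [hu ab.1 (d.degree + 1) (by omega), hu ab.2 (d.degree + 1) (by omega)]
    rw [hd, hS, map_add, coeff_pow_eq_zero_of_degree_lt hs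
      ((Nat.lt_succ_self _).trans Nat.lt_two_pow_self), zero_add]

theorem eq_of_sq_add_self_eq {u v : MvPowerSeries σ K} (hu : constantCoeff u = 0)
    (hv : constantCoeff v = 0) (h : u ^ 2 + u = v ^ 2 + v) : u = v := by
  have h2 := mvPowerSeries_two_eq_zero (σ := σ) (K := K)
  have hunit : IsUnit (u + v + 1) := by
    rw [isUnit_iff_constantCoeff]
    simp [hu, hv]
  have : (u - v) * (u + v + 1) = 0 := by linear_combination h
  exact sub_eq_zero.mp ((hunit.mul_left_eq_zero).mp this)

end ArtinSchreier

open MvPowerSeries in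
/-- Two substitutions that are inverse to each other on the variables give an automorphism of the
power series ring. -/
noncomputable def substAlgEquiv {σ K : Type*} [Finite σ] [Field K] {a b : σ → MvPowerSeries σ K}
    (ha : HasSubst a) (hb : HasSubst b) (hab : ∀ i, subst a (b i) = X i)
    (hba : ∀ i, subst b (a i) = X i) : MvPowerSeries σ K ≃ₐ[K] MvPowerSeries σ K :=
  AlgEquiv.ofAlgHom (substAlgHom ha) (substAlgHom hb)
    (by
      ext1 f
      rw [AlgHom.comp_apply, coe_substAlgHom, coe_substAlgHom, subst_comp_subst_apply hb ha,
        funext hab]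
      exact congrFun subst_self f)
    (by
      ext1 f
      rw [AlgHom.comp_apply, coe_substAlgHom, coe_substAlgHom, subst_comp_subst_apply ha hb,
        funext hba]
      exact congrFun subst_self f)

/-- The equation of `σ₄ + β σ₂² = 0` at a coordinate point. -/
noncomputable def localForm {K : Type*} [Field K] (β : K) : MvPolynomial (Fin 3) K :=
  MvPolynomial.X 0 * MvPolynomial.X 1 * MvPolynomial.X 2 + MvPolynomial.C β *
    (MvPolynomial.X 0 + MvPolynomial.X 1 + MvPolynomial.X 2 +
      (MvPolynomial.X 0 * MvPolynomial.X 1 + MvPolynomial.X 0 * MvPolynomial.X 2 +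
        MvPolynomial.X 1 * MvPolynomial.X 2)) ^ 2

/-! ### The change of coordinates to Artin's form `D₄¹`. -/

section
open MvPowerSeries

variable {K : Type*} [Field K] [CharP K 2]

/-- The form `D₄¹` is `Z² + XY(X + Y + Z)`, and the local equation is `xyz + βw²` with `w` as in
`hw`. In characteristic 2, `w + x + y + xy = z(1 + x + y)`. The substitution `a` is chosen so that
`X + Y + Z` becomes a unit times `z` and `Z` a unit times `w`, with matching unit factors. -/
theorem exists_algEquiv_formD41 {β : K} (hβ : β ≠ 0) :
    ∃ (e : MvPowerSeries (Fin 3) K ≃ₐ[K] MvPowerSeries (Fin 3) K) (ε : MvPowerSeries (Fin 3) K),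
      IsUnit ε ∧ e (formD41 K : MvPowerSeries (Fin 3) K) = ε * (localForm β : MvPowerSeries _ K) := by
  have h2 := mvPowerSeries_two_eq_zero (σ := Fin 3) (K := K)
  obtain ⟨B, hB⟩ : ∃ B : MvPowerSeries (Fin 3) K, B = C β := ⟨_, rfl⟩
  obtain ⟨c, hc⟩ : ∃ c : MvPowerSeries (Fin 3) K, c = C β⁻¹ := ⟨_, rfl⟩
  have hcB : c * B = 1 := by rw [hc, hB, ← map_mul, inv_mul_cancel₀ hβ, map_one]
  obtain ⟨x, hx⟩ : ∃ x : MvPowerSeries (Fin 3) K, x = X 0 := ⟨_, rfl⟩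
  obtain ⟨y, hy⟩ : ∃ y : MvPowerSeries (Fin 3) K, y = X 1 := ⟨_, rfl⟩
  obtain ⟨z, hz⟩ : ∃ z : MvPowerSeries (Fin 3) K, z = X 2 := ⟨_, rfl⟩
  have hx0 : constantCoeff x = 0 := by rw [hx, constantCoeff_X]
  have hy0 : constantCoeff y = 0 := by rw [hy, constantCoeff_X]
  have hz0 : constantCoeff z = 0 := by rw [hz, constantCoeff_X]
  obtain ⟨v', hv⟩ : ∃ v', (1 + x + y) * v' = 1 :=
    ⟨_, MvPowerSeries.mul_inv_cancel _ (by simp [hx0, hy0])⟩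
  obtain ⟨m', hm⟩ : ∃ m', (1 + x) * m' = 1 :=
    ⟨_, MvPowerSeries.mul_inv_cancel _ (by simp [hx0])⟩
  obtain ⟨n', hn⟩ : ∃ n', (1 + B * y) * n' = 1 :=
    ⟨_, MvPowerSeries.mul_inv_cancel _ (by simp [hy0])⟩
  -- To invert `X = x/(β(1+x+y)(1+x))`, `Y = y/(β(1+x+y))`, put `u = x/(1+x)`. Then `u² + u =
  -- x/(1+x)² = βX/(1+βY)`, which determines `u` from `X` and `Y`.
  obtain ⟨u, hu0, hu⟩ := exists_sq_add_self_eq_mvPowerSeries (s := B * x * n') (by simp [hx0])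
  obtain ⟨t, ht⟩ : ∃ t, t = (1 + B * y) * u := ⟨_, rfl⟩
  have ht0 : constantCoeff t = 0 := by rw [ht, map_mul, hu0, mul_zero]
  obtain ⟨r', hr⟩ : ∃ r', (1 + t + B * y) * r' = 1 :=
    ⟨_, MvPowerSeries.mul_inv_cancel _ (by simp [hy0, ht0])⟩
  obtain ⟨w, hw⟩ : ∃ w, w = x + y + z + (x * y + x * z + y * z) := ⟨_, rfl⟩
  have hw0 : constantCoeff w = 0 := by simp [hw, hx0, hy0, hz0]
  obtain ⟨a, ha⟩ : ∃ a : Fin 3 → MvPowerSeries (Fin 3) K,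
      a = ![c * x * v' * m', c * y * v', c * w * v' * m'] := ⟨_, rfl⟩
  -- In the old coordinates `t` is `x/(1+x+y)` and `βY` is `y/(1+x+y)`, so `1 + t + βY = 1/(1+x+y)`
  -- and `r'` is `1+x+y`. This recovers `x`, `y`, then `w`, and finally `z = (w + x + y +
  -- xy)/(1+x+y)`.
  obtain ⟨b, hb⟩ : ∃ b : Fin 3 → MvPowerSeries (Fin 3) K,
      b = ![t * r', B * y * r', (z * B * r' * (1 + B * y) * r' + t * r' + B * y * r' +
        t * r' * (B * y * r')) * (1 + t + B * y)] := ⟨_, rfl⟩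
  have haz : ∀ i, constantCoeff (a i) = 0 := by
    intro i
    rw [ha]
    fin_cases i <;> simp [hx0, hy0, hw0]
  have hbz : ∀ i, constantCoeff (b i) = 0 := by
    intro i
    rw [hb]
    fin_cases i <;> simp [ht0, hy0, hz0]
  have hsa : HasSubst a := hasSubst_of_constantCoeff_zero haz
  have hsb : HasSubst b := hasSubst_of_constantCoeff_zero hbz
  have hab : ∀ i, subst a (b i) = X i := by
    obtain ⟨φ, hφ⟩ : ∃ φ, φ = substAlgHom (R := K) hsa := ⟨_, rfl⟩
    have hφC : ∀ k : K, φ (C k) = C k := fun k => φ.commutes k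
    have hφx : φ x = c * x * v' * m' := by rw [hφ, hx, substAlgHom_X, ← hx, ha]; rfl
    have hφy : φ y = c * y * v' := by rw [hφ, hy, substAlgHom_X, ← hy, ha]; rfl
    have hφz : φ z = c * w * v' * m' := by rw [hφ, hz, substAlgHom_X, ha]; rfl
    have hφB : φ B = B := by rw [hB, hφC]
    have hn₁ := congrArg φ hn
    have hu₁ := congrArg φ hu
    have ht₁ := congrArg φ ht
    have hr₁ := congrArg φ hr
    simp only [map_mul, map_add, map_one, map_pow, hφB, hφx, hφy] at hn₁ hu₁ ht₁ hr₁
    have hN : 1 + B * (c * y * v') = (1 + x) * v' := by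
      linear_combination y * v' * hcB - hv + y * v' * h2
    rw [hN] at hn₁ ht₁
    have hN' : φ n' = m' * (1 + x + y) := by
      linear_combination m' * (1 + x + y) * hn₁ - φ n' * hm - (1 + x) * m' * φ n' * hv
    -- Both sides solve the same Artin–Schreier equation without constant term, and that solution is
    -- unique.
    have hU : φ u = x * m' := by
      refine eq_of_sq_add_self_eq ?_ ?_ ?_
      · rw [hφ, coe_substAlgHom]
        exact constantCoeff_subst_eq_zero hsa haz hu0
      · simp [hx0]
      · rw [hu₁, hN']
        linear_combination (x * v' * m' ^ 2 * (1 + x + y)) * hcB + x * m' ^ 2 * hv +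
          x * m' * hm - x ^ 2 * m' ^ 2 * h2
    have hT : φ t = x * v' := by
      rw [ht₁, hU]
      linear_combination x * v' * hm
    have hE : 1 + x * v' + B * (c * y * v') = v' := by
      linear_combination y * v' * hcB - hv + (x + y) * v' * h2
    have hR : φ r' = 1 + x + y := by
      rw [hT, hE] at hr₁
      linear_combination (1 + x + y) * hr₁ - φ r' * hv
    have hb₀ : φ (t * r') = x := by
      rw [map_mul, hT, hR]
      linear_combination x * hv
    have hb₁ : φ (B * y * r') = y := by
      rw [map_mul, map_mul, hφB, hφy, hR]
      linear_combination y * v' * (1 + x + y) * hcB + y * hv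
    have hb₂ : φ (z * B * r' * (1 + B * y) * r') = w := by
      simp only [map_mul, map_add, map_one, hφB, hφy, hφz, hN, hR]
      linear_combination w * v' ^ 2 * m' * (1 + x) * (1 + x + y) ^ 2 * hcB +
        w * v' ^ 2 * (1 + x + y) ^ 2 * hm + w * (v' * (1 + x + y) + 1) * hv
    have hb₃ : φ (1 + t + B * y) = v' := by
      rw [map_add, map_add, map_one, map_mul, hT, hφB, hφy, hE]
    intro i
    rw [← coe_substAlgHom hsa, ← hφ, hb]
    fin_cases i
    · exact hb₀.trans hx
    · exact hb₁.trans hy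
    · refine Eq.trans ?_ hz
      change φ ((z * B * r' * (1 + B * y) * r' + t * r' + B * y * r' + t * r' * (B * y * r')) *
        (1 + t + B * y)) = z
      rw [map_mul, hb₃, map_add, map_add, map_add, map_mul φ (t * r'), hb₀, hb₁, hb₂, hw]
      linear_combination z * hv + (x + y + x * y) * v' * h2
  have hba : ∀ i, subst b (a i) = X i := by
    obtain ⟨φ, hφ⟩ : ∃ φ, φ = substAlgHom (R := K) hsb := ⟨_, rfl⟩
    have hφC : ∀ k : K, φ (C k) = C k := fun k => φ.commutes k
    have hφx : φ x = t * r' := by rw [hφ, hx, substAlgHom_X, hb]; rfl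
    have hφy : φ y = B * y * r' := by rw [hφ, hy, substAlgHom_X, ← hy, hb]; rfl
    have hφz : φ z = (z * B * r' * (1 + B * y) * r' + t * r' + B * y * r' +
        t * r' * (B * y * r')) * (1 + t + B * y) := by
      rw [hφ, hz, substAlgHom_X, ← hz, hb]; rfl
    have hφc : φ c = c := by rw [hc, hφC]
    have hv₁ := congrArg φ hv
    have hm₁ := congrArg φ hm
    simp only [map_mul, map_add, map_one, hφx, hφy] at hv₁ hm₁
    have hV : φ v' = 1 + t + B * y := by
      linear_combination (1 + t + B * y) * hv₁ - (t + B * y) * φ v' * hr -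
        (t + B * y) * φ v' * h2
    have hM : φ m' = (1 + t + B * y) * n' := by
      linear_combination (1 + t + B * y) * n' * hm₁ - φ m' * hn -
        φ m' * t * n' * (hr + h2)
    have hW : φ w = z * B * r' * (1 + B * y) * r' := by
      rw [hw]
      simp only [map_mul, map_add, hφx, hφy, hφz]
      linear_combination (z * B * r' * (1 + B * y) * r' + t * r' + B * y * r' + t * r' * (B * y * r') -
        (z * B * r' * (1 + B * y) * r' + t * r' + B * y * r' + t * r' * (B * y * r')) * (1 + t + B * y)) * hr +
        ((z * B * r' * (1 + B * y) * r' + t * r' + B * y * r' + t * r' * (B * y * r')) * (1 + t + B * y) *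
          (t + B * y) * r' + (t * r' + B * y * r' + t * r' * (B * y * r'))) * h2
    intro i
    rw [← coe_substAlgHom hsb, ← hφ, ha]
    fin_cases i
    · refine Eq.trans ?_ hx
      change φ (c * x * v' * m') = x
      rw [map_mul, map_mul, map_mul, hφc, hφx, hV, hM]
      subst ht
      linear_combination c * ((1 + B * y) * u) * (1 + (1 + B * y) * u + B * y) * n' * hr +
        c * (1 + (1 + B * y) * u + B * y) * u * hn + c * (1 + B * y) * hu + c * B * x * hn +
        x * hcB
    · refine Eq.trans ?_ hy
      change φ (c * y * v') = y
      rw [map_mul, map_mul, hφc, hφy, hV]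
      linear_combination c * B * y * hr + y * hcB
    · refine Eq.trans ?_ hz
      change φ (c * w * v' * m') = z
      rw [map_mul, map_mul, map_mul, hφc, hW, hV, hM]
      linear_combination c * z * B * n' * (1 + B * y) * (r' * (1 + t + B * y) + 1) * hr +
        c * z * B * hn + z * hcB
  refine ⟨substAlgEquiv hsa hsb hab hba, c ^ 3 * v' ^ 2 * m' ^ 2, ?_, ?_⟩
  · exact (((IsUnit.of_mul_eq_one _ hcB).pow 3).mul
      ((IsUnit.of_mul_eq_one_right _ hv).pow 2)).mul ((IsUnit.of_mul_eq_one_right _ hm).pow 2)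
  · change substAlgHom hsa _ = _
    rw [substAlgHom_coe, formD41, formD40, localForm]
    simp only [map_add, map_mul, map_pow, MvPolynomial.aeval_X, MvPolynomial.coe_add,
      MvPolynomial.coe_mul, MvPolynomial.coe_pow, MvPolynomial.coe_X, MvPolynomial.coe_C,
      ← hx, ← hy, ← hz, ← hB]
    have ha₀ : a 0 = c * x * v' * m' := by rw [ha]; rfl
    have ha₁ : a 1 = c * y * v' := by rw [ha]; rfl
    have ha₂ : a 2 = c * w * v' * m' := by rw [ha]; rfl
    -- This is the factor `X + Y + Z` of the normal form.
    have hs : c * x * v' * m' + c * y * v' + c * w * v' * m' = c * m' * z := by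
      rw [hw]
      linear_combination -(c * y * v') * hm + c * m' * z * hv + c * v' * m' * (x + y + x * y) * h2
    rw [ha₀, ha₁, ha₂, ← hw]
    linear_combination c * x * v' * m' * (c * y * v') * hs - c ^ 2 * w ^ 2 * v' ^ 2 * m' ^ 2 * hcB

end

end SymmetricQuartic
-- Local equations and types of the singular points of the family.
namespace SymmetricQuartic
open MvPolynomial

variable {K : Type*} [Field K] [CharP K 2]

theorem nonempty_completeLocalRing_localForm {β : K} (hβ : β ≠ 0) :
    Nonempty (CompleteLocalRing (localForm β) ≃ₐ[K] CompleteLocalRing (formD41 K)) := by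
  obtain ⟨e, ε, hε, he⟩ := exists_algEquiv_formD41 hβ
  refine ⟨(Ideal.quotientEquivAlg _ _ e ?_).symm⟩
  rw [Ideal.map_span, Set.image_singleton]
  change _ = Ideal.span {e (formD41 K : MvPowerSeries (Fin 3) K)}
  rw [he, Ideal.span_singleton_mul_left_unit hε]

omit [CharP K 2] in
theorem insertNth_one_eq {R : Type*} [CommRing R] (g : Fin 3 → R) :
    (Fin.insertNth (α := fun _ => R) 0 1 g = ![1, g 0, g 1, g 2] ∧
    Fin.insertNth (α := fun _ => R) 1 1 g = ![g 0, 1, g 1, g 2]) ∧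
    Fin.insertNth (α := fun _ => R) 2 1 g = ![g 0, g 1, 1, g 2] ∧
    Fin.insertNth (α := fun _ => R) 3 1 g = ![g 0, g 1, g 2, 1] := by
  refine ⟨⟨?_, ?_⟩, ?_, ?_⟩ <;> ext k <;> fin_cases k <;> rfl

theorem localEquation_family {β : K} (hβ : β ≠ 0) {P : ℙ K (Fin 4 → K)}
    (hP : P ∈ singularPoints (family β)) {i : Fin 4} (hi : P.rep i ≠ 0) :
    localEquation (family β) P i = localForm β := by
  obtain ⟨j, hv, rfl⟩ := (mem_singularPoints_family_iff hβ P).mp hP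
  obtain ⟨a, ha⟩ := Projectivization.exists_smul_eq_mk_rep K _ hv
  have hrep : ∀ k, k ≠ j → (Projectivization.mk K _ hv).rep k = 0 := by
    intro k hk
    rw [← ha, Pi.smul_apply, triplePattern, if_neg hk, smul_zero]
  -- A coordinate point lies in only one standard chart and is its origin, so no translation takes
  -- place.
  obtain rfl : i = j := by
    by_contra h
    exact hi (hrep i h)
  have h0 : ∀ k, (C ((Projectivization.mk K _ hv).rep (i.succAbove k) /
      (Projectivization.mk K _ hv).rep i) + X k : MvPolynomial (Fin 3) K) = X k := by
    intro k
    rw [hrep _ (Fin.succAbove_ne i k), zero_div, C_0, zero_add]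
  rw [localEquation]
  simp only [h0]
  obtain ⟨⟨e0, e1⟩, e2, e3⟩ := insertNth_one_eq (fun k => (X k : MvPolynomial (Fin 3) K))
  rw [family, localForm, esymm_fin_four_two, esymm_fin_four_four]
  fin_cases i
  · simp [e0, algebraMap_eq, -mul_eq_mul_left_iff]; ring
  · simp [e1, algebraMap_eq, -mul_eq_mul_left_iff]; ring
  · simp [e2, algebraMap_eq, -mul_eq_mul_left_iff]; ring
  · simp [e3, algebraMap_eq, -mul_eq_mul_left_iff]; ring

/-- In characteristic 2 the square in `localForm` has no cross term, so the quadratic part is `β(x +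
y + z)²`, the square of a linear form with coefficient `√β`. -/
theorem isUniplanarDoublePoint_family [IsAlgClosed K] {β : K} (hβ : β ≠ 0)
    {P : ℙ K (Fin 4 → K)} (hP : P ∈ singularPoints (family β)) :
    IsUniplanarDoublePoint (family β) P := by
  intro i hi
  rw [localEquation_family hβ hP hi]
  obtain ⟨γ, hγ⟩ := exists_sq_eq β
  have hX := isHomogeneous_X (σ := Fin 3) K
  have hl : (X 0 + X 1 + X 2 : MvPolynomial (Fin 3) K).IsHomogeneous 1 :=
    ((hX 0).add (hX 1)).add (hX 2)
  have hq : (X 0 * X 1 + X 0 * X 2 + X 1 * X 2 : MvPolynomial (Fin 3) K).IsHomogeneous 2 :=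
    (((hX 0).mul (hX 1)).add ((hX 0).mul (hX 2))).add ((hX 1).mul (hX 2))
  have h2 : (2 : MvPolynomial (Fin 3) K) = 0 := CharTwo.two_eq_zero
  have hf : localForm β = (C γ * (X 0 + X 1 + X 2)) ^ 2 + (X 0 * X 1 * X 2 +
      C β * (X 0 * X 1 + X 0 * X 2 + X 1 * X 2) ^ 2) := by
    rw [localForm, mul_pow, ← C_pow, hγ]
    linear_combination C β * (X 0 + X 1 + X 2) * (X 0 * X 1 + X 0 * X 2 + X 1 * X 2) * h2
  have c2 : ((C γ * (X 0 + X 1 + X 2)) ^ 2 : MvPolynomial (Fin 3) K).IsHomogeneous 2 :=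
    (hl.C_mul γ).pow 2
  have c3 : (X 0 * X 1 * X 2 : MvPolynomial (Fin 3) K).IsHomogeneous 3 :=
    ((hX 0).mul (hX 1)).mul (hX 2)
  have c4 : (C β * (X 0 * X 1 + X 0 * X 2 + X 1 * X 2) ^ 2 :
      MvPolynomial (Fin 3) K).IsHomogeneous 4 := (hq.pow 2).C_mul β
  have hcomp : ∀ n, homogeneousComponent n (localForm β) =
      (if n = 2 then (C γ * (X 0 + X 1 + X 2)) ^ 2 else 0) + ((if n = 3 then X 0 * X 1 * X 2 else 0)
        + if n = 4 then C β * (X 0 * X 1 + X 0 * X 2 + X 1 * X 2) ^ 2 else 0) := by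
    intro n
    rw [hf, map_add, map_add, homogeneousComponent_of_mem c2, homogeneousComponent_of_mem c3,
      homogeneousComponent_of_mem c4]
  refine ⟨by simp [hcomp], by simp [hcomp], C γ * (X 0 + X 1 + X 2), hl.C_mul γ, ?_, by
    simp [hcomp]⟩
  intro h
  have := congrArg (eval ![1, 0, 0]) h
  simp only [map_mul, map_add, eval_C, eval_X, map_zero] at this
  have hγ0 : γ = 0 := by simpa using this
  rw [hγ0] at hγ
  exact hβ (by rw [← hγ]; ring)

theorem isTypeD4_family {β : K} (hβ : β ≠ 0) {P : ℙ K (Fin 4 → K)}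
    (hP : P ∈ singularPoints (family β)) : IsTypeD4 (family β) P := by
  intro i hi
  rw [localEquation_family hβ hP hi]
  exact Or.inr (nonempty_completeLocalRing_localForm hβ)

end SymmetricQuartic

theorem mainTheorem9 (K : Type*) [Field K] [IsAlgClosed K] [CharP K 2] :
    IsGreatest {n : ℕ | ∃ F : MvPolynomial (Fin 4) K,
      SymmetricQuartic.IsNormalQuartic F ∧ F.IsSymmetric ∧
        (SymmetricQuartic.singularPoints F).ncard = n} 12 ∧
    ∀ β : K, β ≠ 0 →
      (SymmetricQuartic.singularPoints (SymmetricQuartic.family β)).ncard = 4 ∧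
      ∀ p ∈ SymmetricQuartic.singularPoints (SymmetricQuartic.family β),
        SymmetricQuartic.IsUniplanarDoublePoint (SymmetricQuartic.family β) p ∧
        SymmetricQuartic.IsTypeD4 (SymmetricQuartic.family β) p := by
  refine ⟨⟨SymmetricQuartic.exists_twelve_singularPoints, ?_⟩, fun β hβ =>
    ⟨SymmetricQuartic.ncard_singularPoints_family hβ, fun p hp =>
      ⟨SymmetricQuartic.isUniplanarDoublePoint_family hβ hp,
        SymmetricQuartic.isTypeD4_family hβ hp⟩⟩⟩
  rintro n ⟨F, hF, hs, rfl⟩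
  exact SymmetricQuartic.ncard_singularPoints_le_twelve hF hs
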